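/- **Lemma (Prototypical basis).** Let $d\in\{2,3\}$ and let $\Omega\subset\mathbb R^d$ be a bounded open set (for instance a polygonal Lipschitz domain) whose closure is the union of the elements of a finite, geometrically conforming mesh $\mathcal T_H$ of closed $d$-simplices. Let $0<\alpha\le\beta<\infty$ and let $A\in L^\infty(\Omega,\mathbb R^{d\times d})$ be symmetric with $\alpha|\eta|^2\le (A(x)\eta)\cdot\eta\le\beta|\eta|^2$ for almost all $x\in\Omega$ and all $\eta\in\mathbb R^d$. Put $V:=H^1_0(\Omega)$, $$a(u,v):=\int_\Omega (A\nabla u)\cdot\nabla v\,\mathrm dx,\qquad b(v,\mu):=(v,\mu)_{L^2(\Omega)}.$$ Let $p\in\mathbb N_0$, and let $M_H$ be either the space $\mathcal P^p(\mathcal T_H)$ of $\mathcal T_H$-piecewise polynomials of total degree at most $p$ (DG case) or $\mathcal P^p(\mathcal T_H)\cap H^1(\Omega)$ (CG case). Let $\Lambda_1,\dots,\Lambda_J$ be any basis of $M_H$, denote by $\mu_j$ the coordinates of $\mu\in M_H$, i.e. $\mu=\sum_{j=1}^J\mu_j\Lambda_j$, and set $q_j(v):=\int_{\omega_j}v\,\Lambda_j\,\mathrm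 dx$ with $\omega_j:=\operatorname{supp}(\Lambda_j)$. Define $$W:=\{w\in V:(\mu,w)_{L^2(\Omega)}=0\ \ \forall\mu\in M_H\},\qquad \tilde V_H:=\{v\in V: a(v,w)=0\ \ \forall w\in W\}.$$ Then the following hold. 1. For each $j\in\{1,\dots,J\}$ there is a unique pair $(\tilde\varphi_j,\lambda_j)\in V\times M_H$ such that $$a(\tilde\varphi_j,v)+b(v,\lambda_j)=0\quad\forall v\in V,\qquad\qquad b(\tilde\varphi_j,\mu)=\mu_j\quad\forall\mu\in M_H.$$ 2. The functions $\tilde\varphi_1,\dots,\tilde\varphi_J$ form a basis of $\tilde V_H$. 3. The $a$-orthogonal projection $\mathcal R\colon V\to\tilde V_H$ (the linear map with $a(v-\mathcal Rv,w)=0$ for all $v\in V$, $w\in\tilde V_H$) exists, is unique, and satisfies $$\mathcal R v=\sum_{j=1}^J q_j(v)\,\tilde\varphi_j\qquad\forall v\in V.$$ -/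

import Mathlib

open MeasureTheory TopologicalSpace Matrix
open scoped ENNReal ContDiff Distributions

noncomputable section

namespace LOD

/-- Euclidean space `ℝ^d`. -/
abbrev Space (d : ℕ) : Type := EuclideanSpace ℝ (Fin d)

/-- `L²(Ω)`, real valued. -/
abbrev L2 {d : ℕ} (Ω : Opens (Space d)) : Type :=
  Lp ℝ 2 ((volume : Measure (Space d)).restrict (Ω : Set (Space d)))

/-- `L²(Ω; ℝ^d)`. -/
abbrev L2Vec {d : ℕ} (Ω : Opens (Space d)) : Type :=
  Lp (Space d) 2 ((volume : Measure (Space d)).restrict (Ω : Set (Space d)))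

/-- Pairs `(u, g) ∈ L²(Ω) × L²(Ω; ℝ^d)` with `‖(u, g)‖² = ‖u‖² + ‖g‖²`; for `g = ∇u` this is the
`H¹(Ω)`-norm of `u`. -/
abbrev L2Pair {d : ℕ} (Ω : Opens (Space d)) : Type := WithLp 2 (L2 Ω × L2Vec Ω)

section Sobolev

variable {d : ℕ} {Ω : Opens (Space d)}

lemma memLp_testFunction (φ : 𝓓(Ω, ℝ)) :
    MemLp φ 2 ((volume : Measure (Space d)).restrict (Ω : Set (Space d))) :=
  (φ.continuous.memLp_of_hasCompactSupport φ.hasCompactSupport).restrict _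

lemma memLp_fderiv_testFunction (φ : 𝓓(Ω, ℝ)) (e : Space d) :
    MemLp (fun x => fderiv ℝ φ x e) 2
      ((volume : Measure (Space d)).restrict (Ω : Set (Space d))) := by
  have hc : Continuous (fun x => fderiv ℝ φ x e) :=
    (φ.contDiff.continuous_fderiv (by simp)).clm_apply continuous_const
  exact (hc.memLp_of_hasCompactSupport (φ.hasCompactSupport.fderiv_apply ℝ e)).restrict _

lemma memLp_coord {μ : Measure (Space d)} (g : Lp (Space d) 2 μ) (i : Fin d) :
    MemLp (fun x => g x i) 2 μ :=
  (Lp.memLp g).continuousLinearMap_comp (EuclideanSpace.proj i : Space d →L[ℝ] ℝ)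

/-- `g` is the weak (distributional) gradient of `u` on `Ω`. -/
def IsWeakGradient (u : L2 Ω) (g : L2Vec Ω) : Prop :=
  ∀ (φ : 𝓓(Ω, ℝ)) (i : Fin d),
    ∫ x in (Ω : Set (Space d)), u x * fderiv ℝ φ x (EuclideanSpace.single i 1) =
      -∫ x in (Ω : Set (Space d)), g x i * φ x

/-- The Sobolev space `H¹(Ω)`, each `u` being recorded together with its weak gradient as the pair
`(u, ∇u)`. -/
def H1 (Ω : Opens (Space d)) : Submodule ℝ (L2Pair Ω) where
  carrier := {w | IsWeakGradient w.fst w.snd}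
  zero_mem' := by
    intro φ i
    have h1 := Lp.coeFn_zero ℝ 2 ((volume : Measure (Space d)).restrict (Ω : Set (Space d)))
    have h2 := Lp.coeFn_zero (Space d) 2
      ((volume : Measure (Space d)).restrict (Ω : Set (Space d)))
    rw [integral_congr_ae (g := fun _ => (0 : ℝ)),
      integral_congr_ae (f := fun x => (0 : L2Pair Ω).snd x i * φ x) (g := fun _ => (0 : ℝ))]
    · simp
    · filter_upwards [h2] with x hx
      have h : (0 : L2Pair Ω).snd x = 0 := hx
      rw [h]
      simp
    · filter_upwards [h1] with x hx
      have h : (0 : L2Pair Ω).fst x = 0 := hx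
      rw [h]
      simp
  add_mem' := by
    intro v w hv hw φ i
    have h1 := Lp.coeFn_add v.fst w.fst
    have h2 := Lp.coeFn_add v.snd w.snd
    rw [integral_congr_ae (g := fun x =>
        v.fst x * fderiv ℝ φ x (EuclideanSpace.single i 1) +
          w.fst x * fderiv ℝ φ x (EuclideanSpace.single i 1)),
      integral_congr_ae (f := fun x => (v + w).snd x i * φ x)
        (g := fun x => v.snd x i * φ x + w.snd x i * φ x),
      integral_add, integral_add, hv φ i, hw φ i]
    · ring
    · exact (memLp_coord v.snd i).integrable_mul (memLp_testFunction φ)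
    · exact (memLp_coord w.snd i).integrable_mul (memLp_testFunction φ)
    · exact (Lp.memLp v.fst).integrable_mul (memLp_fderiv_testFunction φ _)
    · exact (Lp.memLp w.fst).integrable_mul (memLp_fderiv_testFunction φ _)
    · filter_upwards [h2] with x hx
      have h : (v + w).snd x = v.snd x + w.snd x := hx
      rw [h, PiLp.add_apply, add_mul]
    · filter_upwards [h1] with x hx
      have h : (v + w).fst x = v.fst x + w.fst x := hx
      rw [h, add_mul]
  smul_mem' := by
    intro c w hw φ i
    have h1 := Lp.coeFn_smul c w.fst
    have h2 := Lp.coeFn_smul c w.snd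
    rw [integral_congr_ae (g := fun x =>
        c * (w.fst x * fderiv ℝ φ x (EuclideanSpace.single i 1))),
      integral_congr_ae (f := fun x => (c • w).snd x i * φ x)
        (g := fun x => c * (w.snd x i * φ x)),
      integral_const_mul, integral_const_mul, hw φ i]
    · ring
    · filter_upwards [h2] with x hx
      have h : (c • w).snd x = c • w.snd x := hx
      rw [h, PiLp.smul_apply, smul_eq_mul, mul_assoc]
    · filter_upwards [h1] with x hx
      have h : (c • w).fst x = c • w.fst x := hx
      rw [h, smul_eq_mul, mul_assoc]

/-- The pairs `(φ, ∇φ)` with `φ ∈ C_c^∞(Ω)`. -/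
def testPairs (Ω : Opens (Space d)) : Set (L2Pair Ω) :=
  {w | ∃ φ : 𝓓(Ω, ℝ),
    (w.fst =ᵐ[(volume : Measure (Space d)).restrict (Ω : Set (Space d))] φ) ∧
    (w.snd =ᵐ[(volume : Measure (Space d)).restrict (Ω : Set (Space d))] gradient φ)}

/-- `H¹₀(Ω)`: the closure of `C_c^∞(Ω)` in the `H¹(Ω)`-norm. Its elements are pairs `(u, ∇u)`. -/
def H10 (Ω : Opens (Space d)) : Submodule ℝ (L2Pair Ω) :=
  (Submodule.span ℝ (testPairs Ω)).topologicalClosure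

/-- The function underlying an element of `H¹₀(Ω)`. -/
def val (u : H10 Ω) : L2 Ω := (u : L2Pair Ω).fst

/-- The weak gradient of an element of `H¹₀(Ω)`. -/
def grad (u : H10 Ω) : L2Vec Ω := (u : L2Pair Ω).snd

end Sobolev

section Energy

variable {d : ℕ}

/-- A symmetric coefficient `A ∈ L^∞(Ω; ℝ^{d×d})` with
`α |η|² ≤ (A(x) η) · η ≤ β |η|²` for almost all `x ∈ Ω` and all `η ∈ ℝ^d`. -/
structure Coefficient (Ω : Opens (Space d)) (α β : ℝ) where
  toFun : Space d → Matrix (Fin d) (Fin d) ℝ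
  memLp_top : ∀ i j, MemLp (fun x => toFun x i j) ∞
    ((volume : Measure (Space d)).restrict (Ω : Set (Space d)))
  symm : ∀ᵐ x ∂((volume : Measure (Space d)).restrict (Ω : Set (Space d))), (toFun x).IsSymm
  elliptic : ∀ᵐ x ∂((volume : Measure (Space d)).restrict (Ω : Set (Space d))), ∀ η : Space d,
    α * ‖η‖ ^ 2 ≤ (toFun x *ᵥ η.ofLp) ⬝ᵥ η.ofLp ∧ (toFun x *ᵥ η.ofLp) ⬝ᵥ η.ofLp ≤ β * ‖η‖ ^ 2

variable {Ω : Opens (Space d)} {α β : ℝ}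

lemma integrable_energy (A : Coefficient Ω α β) (g h : L2Vec Ω) :
    Integrable (fun x => (A.toFun x *ᵥ (g x).ofLp) ⬝ᵥ (h x).ofLp)
      ((volume : Measure (Space d)).restrict (Ω : Set (Space d))) := by
  simp only [dotProduct, mulVec, Finset.sum_mul]
  refine integrable_finsetSum _ fun i _ => integrable_finsetSum _ fun j _ => ?_
  exact ((memLp_coord g j).mul (A.memLp_top i j) (r := 2)).integrable_mul (memLp_coord h i)

/-- The energy inner product `a(u, v) = ∫_Ω (A ∇u) · ∇v dx` on `V = H¹₀(Ω)`. -/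
def energy (A : Coefficient Ω α β) : H10 Ω →ₗ[ℝ] H10 Ω →ₗ[ℝ] ℝ :=
  LinearMap.mk₂ ℝ
    (fun u v => ∫ x in (Ω : Set (Space d)), (A.toFun x *ᵥ (grad u x).ofLp) ⬝ᵥ (grad v x).ofLp)
    (by
      intro u v w
      rw [← integral_add (integrable_energy A _ _) (integrable_energy A _ _)]
      refine integral_congr_ae ?_
      filter_upwards [Lp.coeFn_add (grad u) (grad v)] with x hx
      have : grad (u + v) x = grad u x + grad v x := hx
      simp [this, mulVec_add, add_dotProduct])
    (by
      intro c u w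
      rw [smul_eq_mul, ← integral_const_mul]
      refine integral_congr_ae ?_
      filter_upwards [Lp.coeFn_smul c (grad u)] with x hx
      have : grad (c • u) x = c • grad u x := hx
      simp [this, mulVec_smul, smul_dotProduct])
    (by
      intro w u v
      rw [← integral_add (integrable_energy A _ _) (integrable_energy A _ _)]
      refine integral_congr_ae ?_
      filter_upwards [Lp.coeFn_add (grad u) (grad v)] with x hx
      have : grad (u + v) x = grad u x + grad v x := hx
      simp [this, dotProduct_add])
    (by
      intro c w u
      rw [smul_eq_mul, ← integral_const_mul]
      refine integral_congr_ae ?_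
      filter_upwards [Lp.coeFn_smul c (grad u)] with x hx
      have : grad (c • u) x = c • grad u x := hx
      simp [this, dotProduct_smul])

end Energy

section FiniteElements

variable {d : ℕ}

/-- A geometrically conforming simplicial mesh: a finite, pure `d`-dimensional simplicial complex
whose underlying set is the closure of `Ω`. -/
structure Mesh (Ω : Opens (Space d)) where
  complex : Geometry.SimplicialComplex ℝ (Space d)
  finite_faces : complex.faces.Finite
  pure : ∀ s ∈ complex.faces, ∃ t ∈ complex.faces, s ⊆ t ∧ t.card = d + 1
  space_eq : complex.space = closure (Ω : Set (Space d))

variable {Ω : Opens (Space d)}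

/-- The elements of the mesh: its closed `d`-simplices. -/
def Mesh.elements (𝒯 : Mesh Ω) : Set (Set (Space d)) :=
  {T | ∃ t ∈ 𝒯.complex.faces, t.card = d + 1 ∧ T = convexHull ℝ (t : Set (Space d))}

/-- `f` agrees almost everywhere on `Ω ∩ T` with a polynomial of total degree at most `p`. -/
def IsPolynomialOn (p : ℕ) (f : L2 Ω) (T : Set (Space d)) : Prop :=
  ∃ P : MvPolynomial (Fin d) ℝ, P.totalDegree ≤ p ∧
    f =ᵐ[((volume : Measure (Space d)).restrict (Ω : Set (Space d))).restrict T]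
      fun x => MvPolynomial.eval (x.ofLp) P

/-- The DG space `𝒫^p(𝒯)` of `𝒯`-piecewise polynomials of total degree at most `p`. -/
def dgSpace (𝒯 : Mesh Ω) (p : ℕ) : Submodule ℝ (L2 Ω) where
  carrier := {f | ∀ T ∈ 𝒯.elements, IsPolynomialOn p f T}
  zero_mem' := fun T _ => ⟨0, by simp, by
    filter_upwards [ae_restrict_of_ae (s := T)
      (Lp.coeFn_zero ℝ 2 ((volume : Measure (Space d)).restrict (Ω : Set (Space d))))] with x hx
    rw [hx]
    simp⟩
  add_mem' := by
    intro f g hf hg T hT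
    obtain ⟨P, hP, hfP⟩ := hf T hT
    obtain ⟨Q, hQ, hgQ⟩ := hg T hT
    refine ⟨P + Q, (MvPolynomial.totalDegree_add P Q).trans (max_le hP hQ), ?_⟩
    filter_upwards [ae_restrict_of_ae (s := T) (Lp.coeFn_add f g), hfP, hgQ] with x hx h1 h2
    rw [hx, Pi.add_apply, h1, h2, map_add]
  smul_mem' := by
    intro c f hf T hT
    obtain ⟨P, hP, hfP⟩ := hf T hT
    refine ⟨c • P, (MvPolynomial.totalDegree_smul_le c P).trans hP, ?_⟩
    filter_upwards [ae_restrict_of_ae (s := T) (Lp.coeFn_smul c f), hfP] with x hx h1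
    rw [hx, Pi.smul_apply, h1, MvPolynomial.smul_eval, smul_eq_mul]

/-- The CG space `𝒫^p(𝒯) ∩ H¹(Ω)`. -/
def cgSpace (𝒯 : Mesh Ω) (p : ℕ) : Submodule ℝ (L2 Ω) :=
  dgSpace 𝒯 p ⊓ (H1 Ω).map (WithLp.fstₗ 2 ℝ (L2 Ω) (L2Vec Ω))

/-- The two variants of the method: discontinuous or continuous Galerkin. -/
inductive Variant
  | dg
  | cg

/-- The finite element space `M_H`. -/
def femSpace (κ : Variant) (𝒯 : Mesh Ω) (p : ℕ) : Submodule ℝ (L2 Ω) :=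
  match κ with
  | .dg => dgSpace 𝒯 p
  | .cg => cgSpace 𝒯 p

/-- `b(v, μ) = (v, μ)_{L²(Ω)}`. -/
def pairing (v : H10 Ω) (μ : L2 Ω) : ℝ :=
  ∫ x in (Ω : Set (Space d)), val v x * μ x

/-- The (essential) support of `f ∈ L²(Ω)`: the smallest closed set outside of which `f`
vanishes almost everywhere. -/
def essSupport (f : L2 Ω) : Set (Space d) :=
  (((volume : Measure (Space d)).restrict (Ω : Set (Space d))).withDensity
    (fun x => ‖f x‖ₑ)).support

/-- The quantity of interest `q(v) = ∫_{supp Λ} v Λ dx` associated with `Λ ∈ M_H`. -/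
def qoi (Λ : L2 Ω) (v : H10 Ω) : ℝ :=
  ∫ x in (Ω : Set (Space d)) ∩ essSupport Λ, val v x * Λ x

end FiniteElements

section Method

variable {d : ℕ} {Ω : Opens (Space d)} {α β : ℝ}

/-- The fine-scale space `W = {w ∈ V : (μ, w)_Ω = 0 for all μ ∈ M}`. -/
def fineScale (M : Submodule ℝ (L2 Ω)) : Set (H10 Ω) :=
  {w | ∀ μ ∈ M, pairing w μ = 0}

/-- The multiscale space `Ṽ = {v ∈ V : a(v, w) = 0 for all w ∈ W}`. -/
def multiscale (A : Coefficient Ω α β) (M : Submodule ℝ (L2 Ω)) : Submodule ℝ (H10 Ω) where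
  carrier := {v | ∀ w ∈ fineScale M, energy A v w = 0}
  zero_mem' := fun w _ => by simp
  add_mem' := fun hu hv w hw => by simp [hu w hw, hv w hw]
  smul_mem' := fun c u hu w hw => by simp [hu w hw]

/-- `R : V → Ṽ` is the `a`-orthogonal projection onto `Ṽ`. -/
def IsEnergyProjection (A : Coefficient Ω α β) (M : Submodule ℝ (L2 Ω))
    (R : H10 Ω →ₗ[ℝ] multiscale A M) : Prop :=
  ∀ v : H10 Ω, ∀ w ∈ multiscale A M, energy A (v - (R v : H10 Ω)) w = 0

/-- `(φ, lam) ∈ V × M` solves the `j`-th saddle point problem: `a(φ, v) + b(v, lam) = 0` for all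
`v ∈ V` and `b(φ, μ) = μ_j` for all `μ ∈ M`, with `μ_j` the `j`-th coordinate of `μ` in the
basis `Λ` of `M`. -/
def IsSaddlePoint (A : Coefficient Ω α β) {M : Submodule ℝ (L2 Ω)} {J : ℕ}
    (Λ : Module.Basis (Fin J) ℝ M) (j : Fin J) (φ : H10 Ω) (lam : M) : Prop :=
  (∀ v : H10 Ω, energy A φ v + pairing v (lam : L2 Ω) = 0) ∧
    ∀ μ : M, pairing φ (μ : L2 Ω) = Λ.repr μ j

end Method

end LOD

end

/-! The proof rests on the moment map `moments`, `v ↦ (b(v, Λ_i))_i`, which is a linear isomorphism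
from the multiscale space `Ṽ` onto `ℝ^J` (`moments_bijective`). It is injective because an element
of `Ṽ` with zero moments lies in `W`, so it is `a`-orthogonal to itself and vanishes by coercivity.
It is surjective by dimension: the Lax–Milgram representatives of the functionals `b(·, Λ_i)` lie in
`Ṽ` and are `J` independent vectors, since `H¹₀(Ω)` is dense in `L²(Ω)`.

Then `φ̃_j` is the preimage of the `j`-th unit vector. Its multiplier exists because `a(φ̃_j, ·)`
vanishes on `W`, a common kernel of finitely many functionals, and so is a combination of them;
density makes it unique. The projection `R v` is the element of `Ṽ` with the moments of `v`, and its
coordinates in the basis `φ̃_j` are these moments, which equal `q_j(v)`. -/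

namespace LOD

/-! ### Poincaré's inequality and completeness of `H¹₀(Ω)`. -/

section Poincare

variable {d : ℕ} {Ω : Opens (Space d)}

/-- Poincaré's inequality for smooth compactly supported functions. -/
lemma integral_sq_le_of_contDiff {φ : Space d → ℝ} (hφ : ContDiff ℝ ∞ φ)
    (hc : HasCompactSupport φ) {r : ℝ} (hr : ∀ x, φ x ≠ 0 → ‖x‖ ≤ r) (i : Fin d) :
    ∫ x, φ x ^ 2 ≤ 4 * r ^ 2 * ∫ x, fderiv ℝ φ x (EuclideanSpace.single i 1) ^ 2 := by
  set e : Space d := EuclideanSpace.single i 1 with he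
  let ℓ : Space d →L[ℝ] ℝ := EuclideanSpace.proj i
  have hℓe : ℓ e = 1 := by simp [ℓ, he]
  have hφc : Continuous φ := hφ.continuous
  have hdc : Continuous fun x => fderiv ℝ φ x e :=
    (hφ.continuous_fderiv (by simp)).clm_apply continuous_const
  have hd : Differentiable ℝ φ := hφ.differentiable (by simp)
  have hds : HasCompactSupport fun x => fderiv ℝ φ x e := hc.fderiv_apply ℝ e
  have hg : ∀ x, fderiv ℝ (fun y => φ y * ℓ y) x e = φ x + fderiv ℝ φ x e * ℓ x := by
    intro x
    rw [fderiv_fun_mul (hd x) ℓ.differentiableAt]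
    simp [hℓe, mul_comm]
  have hI1 : Integrable fun x => φ x ^ 2 :=
    (hφc.pow 2).integrable_of_hasCompactSupport (by simpa [sq] using hc.mul_left (f' := φ))
  have hI2 : Integrable fun x => fderiv ℝ φ x e ^ 2 :=
    (hdc.pow 2).integrable_of_hasCompactSupport (by
      simpa [sq] using hds.mul_left (f' := fun x => fderiv ℝ φ x e))
  have hI3 : Integrable fun x => fderiv ℝ φ x e * (φ x * ℓ x) :=
    (hdc.mul (hφc.mul ℓ.continuous)).integrable_of_hasCompactSupport hds.mul_right
  -- The coordinate `ℓ` has derivative `1` along `e`, so integrating `φ ∂(φ ℓ)` by parts yields `∫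
  -- φ² = -2 ∫ φ ℓ ∂φ`.
  have key : ∫ x, φ x * fderiv ℝ (fun y => φ y * ℓ y) x e =
      -∫ x, fderiv ℝ φ x e * (φ x * ℓ x) := by
    refine integral_mul_fderiv_eq_neg_fderiv_mul_of_integrable hI3 ?_ ?_
      (fun x _ => hd x) (fun x _ => (hd x).mul ℓ.differentiableAt)
    · simp_rw [hg]
      exact (hφc.mul (hφc.add (hdc.mul ℓ.continuous))).integrable_of_hasCompactSupport
        hc.mul_right
    · exact (hφc.mul (hφc.mul ℓ.continuous)).integrable_of_hasCompactSupport hc.mul_right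
  have key2 : ∫ x, φ x * fderiv ℝ (fun y => φ y * ℓ y) x e =
      (∫ x, φ x ^ 2) + ∫ x, fderiv ℝ φ x e * (φ x * ℓ x) := by
    rw [← integral_add hI1 hI3]
    refine integral_congr_ae (.of_forall fun x => ?_)
    simp only [hg]
    ring
  -- Young's inequality `-2st ≤ s²/2 + 2t²` with `s = φ`, `t = ℓ ∂φ`; absorbing the half on the left
  -- produces the constant `4 r²`.
  have hYoung : -(2 * ∫ x, fderiv ℝ φ x e * (φ x * ℓ x)) ≤
      (1 / 2) * (∫ x, φ x ^ 2) + 2 * r ^ 2 * ∫ x, fderiv ℝ φ x e ^ 2 := by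
    rw [← integral_const_mul, ← integral_const_mul, ← integral_const_mul, ← integral_neg,
      ← integral_add (hI1.const_mul _) (hI2.const_mul _)]
    refine integral_mono (hI3.const_mul _).neg
      ((hI1.const_mul _).add (hI2.const_mul _)) fun x => ?_
    dsimp only
    by_cases hx : φ x = 0
    · simp only [hx]
      have : 0 ≤ 2 * r ^ 2 * fderiv ℝ φ x e ^ 2 := by positivity
      simpa using this
    · have h1 : ℓ x ^ 2 ≤ r ^ 2 := by
        refine sq_le_sq' ?_ ?_
        · have := neg_abs_le (ℓ x)
          have h2 : |ℓ x| ≤ ‖x‖ := PiLp.norm_apply_le x i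
          linarith [hr x hx]
        · exact (le_abs_self _).trans ((PiLp.norm_apply_le x i).trans (hr x hx))
      have h2 := mul_le_mul_of_nonneg_right h1 (sq_nonneg (fderiv ℝ φ x e))
      nlinarith [sq_nonneg (φ x + 2 * (ℓ x * fderiv ℝ φ x e))]
  linarith

lemma sq_norm_eq_integral {F : Type*} [NormedAddCommGroup F] [InnerProductSpace ℝ F]
    {X : Type*} [MeasurableSpace X] {ν : Measure X} (f : Lp F 2 ν) :
    ‖f‖ ^ 2 = ∫ x, ‖f x‖ ^ 2 ∂ν := by
  rw [← real_inner_self_eq_norm_sq, L2.inner_def]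
  simp_rw [real_inner_self_eq_norm_sq]

lemma fderiv_single_sq_le_gradient (φ : Space d → ℝ) (x : Space d) (i : Fin d) :
    fderiv ℝ φ x (EuclideanSpace.single i 1) ^ 2 ≤ ‖gradient φ x‖ ^ 2 := by
  rw [sq_le_sq, abs_norm, ← Real.norm_eq_abs, gradient, LinearIsometryEquiv.norm_map]
  simpa using (fderiv ℝ φ x).le_opNorm (EuclideanSpace.single i (1 : ℝ))

lemma integrable_sq_gradient (φ : 𝓓(Ω, ℝ)) : Integrable fun x => ‖gradient φ x‖ ^ 2 := by
  have h : (fun x => ‖gradient φ x‖ ^ 2) = fun x => ‖fderiv ℝ φ x‖ ^ 2 := by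
    ext x
    rw [gradient, LinearIsometryEquiv.norm_map]
  rw [h]
  refine ((φ.contDiff.continuous_fderiv (by simp)).norm.pow 2).integrable_of_hasCompactSupport ?_
  have := (φ.hasCompactSupport.fderiv ℝ).norm
  simpa [sq] using this.mul_left (f' := fun x => ‖fderiv ℝ φ x‖)

/-- A test function and its gradient vanish off `Ω`, so both norms are integrals over the whole
space, and one partial derivative is dominated by the gradient. -/
lemma norm_fst_le_of_mem_testPairs {r : ℝ} (hr0 : 0 ≤ r)
    (hr : ∀ x ∈ (Ω : Set (Space d)), ‖x‖ ≤ r) (i : Fin d)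
    {w : L2Pair Ω} (hw : w ∈ testPairs Ω) : ‖w.fst‖ ≤ 2 * r * ‖w.snd‖ := by
  obtain ⟨φ, h1, h2⟩ := hw
  have hφ0 : ∀ x, x ∉ (Ω : Set (Space d)) → φ x = 0 := fun x hx =>
    image_eq_zero_of_notMem_tsupport fun h => hx (φ.tsupport_subset h)
  have hg0 : ∀ x, x ∉ (Ω : Set (Space d)) → gradient φ x = 0 := fun x hx => by
    rw [gradient, image_eq_zero_of_notMem_tsupport (f := fderiv ℝ (φ : Space d → ℝ)), map_zero]
    exact fun h => hx (φ.tsupport_subset (tsupport_fderiv_subset ℝ h))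
  have e1 : ‖w.fst‖ ^ 2 = ∫ x, φ x ^ 2 := by
    rw [sq_norm_eq_integral, ← setIntegral_eq_integral_of_forall_compl_eq_zero
      (s := (Ω : Set (Space d))) (f := fun x => φ x ^ 2)]
    · refine integral_congr_ae ?_
      filter_upwards [h1] with x hx
      rw [hx, Real.norm_eq_abs, sq_abs]
    · intro x hx
      rw [hφ0 x hx]
      simp
  have e2 : ‖w.snd‖ ^ 2 = ∫ x, ‖gradient φ x‖ ^ 2 := by
    rw [sq_norm_eq_integral, ← setIntegral_eq_integral_of_forall_compl_eq_zero
      (s := (Ω : Set (Space d))) (f := fun x => ‖gradient φ x‖ ^ 2)]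
    · refine integral_congr_ae ?_
      filter_upwards [h2] with x hx
      rw [hx]
    · intro x hx
      rw [hg0 x hx]
      simp
  refine (sq_le_sq₀ (norm_nonneg _) (by positivity)).1 ?_
  rw [mul_pow, e1, e2]
  have h3 := integral_sq_le_of_contDiff φ.contDiff φ.hasCompactSupport
    (r := r) (fun x hx => hr x (by by_contra h; exact hx (hφ0 x h))) i
  have h4 : ∫ x, fderiv ℝ φ x (EuclideanSpace.single i 1) ^ 2 ≤ ∫ x, ‖gradient φ x‖ ^ 2 :=
    integral_mono_of_nonneg (.of_forall fun x => sq_nonneg _) (integrable_sq_gradient φ)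
      (.of_forall fun x => fderiv_single_sq_le_gradient φ x i)
  calc _ ≤ _ := h3
    _ ≤ 4 * r ^ 2 * ∫ x, ‖gradient φ x‖ ^ 2 := by gcongr
    _ = _ := by ring

lemma gradient_testFunction_add (φ ψ : 𝓓(Ω, ℝ)) (x : Space d) :
    gradient (φ + ψ : 𝓓(Ω, ℝ)) x = gradient φ x + gradient ψ x := by
  rw [gradient, gradient, gradient, ← map_add, FunLike.coe_add, fderiv_add]
  · exact (φ.contDiff.differentiable (by simp)) x
  · exact (ψ.contDiff.differentiable (by simp)) x

lemma gradient_testFunction_smul (c : ℝ) (φ : 𝓓(Ω, ℝ)) (x : Space d) :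
    gradient (c • φ : 𝓓(Ω, ℝ)) x = c • gradient φ x := by
  have h : fderiv ℝ (c • φ : 𝓓(Ω, ℝ)) x = c • fderiv ℝ φ x := by
    rw [FunLike.coe_smul, fderiv_const_smul]
    exact (φ.contDiff.differentiable (by simp)) x
  rw [gradient, gradient, h]
  simp

/-- The span in `H10` adds nothing. This matters because an inequality between norms does not pass
to linear combinations by itself. -/
lemma mem_testPairs_of_mem_span {w : L2Pair Ω} (hw : w ∈ Submodule.span ℝ (testPairs Ω)) :
    w ∈ testPairs Ω := by
  induction hw using Submodule.span_induction with
  | mem w hw => exact hw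
  | zero =>
    refine ⟨0, ?_, ?_⟩
    · exact Lp.coeFn_zero ℝ 2 ((volume : Measure (Space d)).restrict (Ω : Set (Space d)))
    · have h := Lp.coeFn_zero (Space d) 2
        ((volume : Measure (Space d)).restrict (Ω : Set (Space d)))
      filter_upwards [h] with x hx
      refine Eq.trans hx ?_
      simp [gradient]
  | add v w _ _ hv hw =>
    obtain ⟨φ, h1, h2⟩ := hv
    obtain ⟨ψ, h3, h4⟩ := hw
    refine ⟨φ + ψ, ?_, ?_⟩
    · filter_upwards [Lp.coeFn_add v.fst w.fst, h1, h3] with x hx hx1 hx3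
      refine Eq.trans hx ?_
      simp [hx1, hx3]
    · filter_upwards [Lp.coeFn_add v.snd w.snd, h2, h4] with x hx hx2 hx4
      refine Eq.trans hx ?_
      rw [Pi.add_apply, hx2, hx4, gradient_testFunction_add]
  | smul c w _ hw =>
    obtain ⟨φ, h1, h2⟩ := hw
    refine ⟨c • φ, ?_, ?_⟩
    · filter_upwards [Lp.coeFn_smul c w.fst, h1] with x hx hx1
      refine Eq.trans hx ?_
      simp [hx1]
    · filter_upwards [Lp.coeFn_smul c w.snd, h2] with x hx hx2
      refine Eq.trans hx ?_
      rw [Pi.smul_apply, hx2, gradient_testFunction_smul]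

/-- Poincaré's inequality on `H¹₀(Ω)`. -/
lemma norm_val_le_grad {r : ℝ} (hr0 : 0 ≤ r)
    (hr : ∀ x ∈ (Ω : Set (Space d)), ‖x‖ ≤ r) (i : Fin d) (u : H10 Ω) :
    ‖val u‖ ≤ 2 * r * ‖grad u‖ := by
  -- The inequality is a closed condition, so it extends from test pairs to their closure.
  have hcl : IsClosed {w : L2Pair Ω | ‖w.fst‖ ≤ 2 * r * ‖w.snd‖} :=
    isClosed_le (WithLp.fstL 2 ℝ (L2 Ω) (L2Vec Ω)).continuous.norm
      (continuous_const.mul (WithLp.sndL 2 ℝ (L2 Ω) (L2Vec Ω)).continuous.norm)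
  exact closure_minimal (fun w hw =>
    norm_fst_le_of_mem_testPairs hr0 hr i (mem_testPairs_of_mem_span hw)) hcl u.2

lemma sq_norm_H10 (u : H10 Ω) : ‖u‖ ^ 2 = ‖val u‖ ^ 2 + ‖grad u‖ ^ 2 := by
  rw [Submodule.coe_norm, WithLp.prod_norm_sq_eq_of_L2]
  rfl

instance completeSpace_H10 : CompleteSpace (H10 Ω) := by
  unfold H10
  infer_instance

end Poincare

/-! ### Continuity and coercivity of the energy form, and Lax–Milgram. -/

section EnergyForm

variable {d : ℕ} {Ω : Opens (Space d)} {α β : ℝ}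

lemma energy_apply (A : Coefficient Ω α β) (u v : H10 Ω) :
    energy A u v =
      ∫ x in (Ω : Set (Space d)), (A.toFun x *ᵥ (grad u x).ofLp) ⬝ᵥ (grad v x).ofLp :=
  rfl

lemma energy_comm (A : Coefficient Ω α β) (u v : H10 Ω) : energy A u v = energy A v u := by
  rw [energy_apply, energy_apply]
  refine integral_congr_ae ?_
  filter_upwards [A.symm] with x hx
  rw [dotProduct_comm, dotProduct_mulVec, ← mulVec_transpose, hx.eq]

lemma le_energy_self (A : Coefficient Ω α β) (u : H10 Ω) :
    α * ‖grad u‖ ^ 2 ≤ energy A u u := by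
  rw [energy_apply, sq_norm_eq_integral, ← integral_const_mul]
  refine integral_mono_ae ((Lp.memLp (grad u)).integrable_norm_pow (by simp) |>.const_mul α)
    (integrable_energy A _ _) ?_
  filter_upwards [A.elliptic] with x hx
  exact (hx _).1

lemma energy_self_le (A : Coefficient Ω α β) (u : H10 Ω) :
    energy A u u ≤ β * ‖grad u‖ ^ 2 := by
  rw [energy_apply, sq_norm_eq_integral, ← integral_const_mul]
  refine integral_mono_ae (integrable_energy A _ _)
    ((Lp.memLp (grad u)).integrable_norm_pow (by simp) |>.const_mul β) ?_
  filter_upwards [A.elliptic] with x hx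
  exact (hx _).2

/-- Cauchy–Schwarz for the symmetric nonnegative form `a` reduces the bound to the diagonal, where
ellipticity gives `β`. -/
lemma abs_energy_le (A : Coefficient Ω α β) (hα : 0 < α) (hαβ : α ≤ β) (u v : H10 Ω) :
    |energy A u v| ≤ β * ‖u‖ * ‖v‖ := by
  have hβ : 0 < β := hα.trans_le hαβ
  have hpos : ∀ w : H10 Ω, 0 ≤ energy A w w := fun w =>
    le_trans (by positivity) (le_energy_self A w)
  have hle : ∀ w : H10 Ω, energy A w w ≤ β * ‖w‖ ^ 2 := fun w =>
    (energy_self_le A w).trans (by rw [sq_norm_H10]; gcongr; simp)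
  have hcs := LinearMap.BilinForm.apply_sq_le_of_symm (energy A) hpos
    ⟨fun x y => energy_comm A x y⟩ u v
  refine abs_le_of_sq_le_sq ?_ (by positivity)
  calc energy A u v ^ 2 ≤ energy A u u * energy A v v := hcs
    _ ≤ (β * ‖u‖ ^ 2) * (β * ‖v‖ ^ 2) := mul_le_mul (hle u) (hle v) (hpos v) (by positivity)
    _ = (β * ‖u‖ * ‖v‖) ^ 2 := by ring

lemma exists_coercive (A : Coefficient Ω α β) (hα : 0 < α)
    (hΩ : Bornology.IsBounded (Ω : Set (Space d))) (i : Fin d) :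
    ∃ c, 0 < c ∧ ∀ u : H10 Ω, c * ‖u‖ * ‖u‖ ≤ energy A u u := by
  obtain ⟨r, hr0, hr⟩ := hΩ.exists_pos_norm_le
  -- Poincaré gives `‖u‖² ≤ (4 r² + 1) ‖∇u‖²` in the full norm.
  refine ⟨α / (4 * r ^ 2 + 1), by positivity, fun u => le_trans ?_ (le_energy_self A u)⟩
  have h1 := norm_val_le_grad hr0.le hr i u
  have h2 : ‖val u‖ ^ 2 ≤ 4 * r ^ 2 * ‖grad u‖ ^ 2 := by
    calc ‖val u‖ ^ 2 ≤ (2 * r * ‖grad u‖) ^ 2 := by gcongr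
      _ = _ := by ring
  rw [mul_assoc, ← sq, sq_norm_H10, div_mul_eq_mul_div, div_le_iff₀ (by positivity), mul_assoc]
  gcongr
  linarith

/-- The Lax–Milgram lemma for the energy form. -/
lemma exists_energy_eq (A : Coefficient Ω α β) (hα : 0 < α) (hαβ : α ≤ β)
    (hΩ : Bornology.IsBounded (Ω : Set (Space d))) (i : Fin d) (ℓ : H10 Ω →L[ℝ] ℝ) :
    ∃ ψ : H10 Ω, ∀ v, energy A ψ v = ℓ v := by
  let B : H10 Ω →L[ℝ] H10 Ω →L[ℝ] ℝ :=
    LinearMap.mkContinuous₂ (energy A) β (abs_energy_le A hα hαβ)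
  have hB : IsCoercive B := exists_coercive A hα hΩ i
  refine ⟨hB.continuousLinearEquivOfBilin.symm ((InnerProductSpace.toDual ℝ (H10 Ω)).symm ℓ),
    fun v => ?_⟩
  change B _ v = ℓ v
  rw [← hB.continuousLinearEquivOfBilin_apply, ContinuousLinearEquiv.apply_symm_apply,
    InnerProductSpace.toDual_symm_apply]

lemma eq_zero_of_energy_self (A : Coefficient Ω α β) (hα : 0 < α)
    (hΩ : Bornology.IsBounded (Ω : Set (Space d))) (i : Fin d) {u : H10 Ω}
    (hu : energy A u u = 0) : u = 0 := by
  obtain ⟨c, hc, h⟩ := exists_coercive A hα hΩ i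
  have := h u
  rw [hu, mul_assoc] at this
  have h2 : ‖u‖ * ‖u‖ ≤ 0 := nonpos_of_mul_nonpos_right this hc
  exact norm_eq_zero.1 (mul_self_eq_zero.1 (le_antisymm h2 (mul_self_nonneg _)))

end EnergyForm

/-! ### The `L²` pairing, density of `H¹₀(Ω)`, and the quantities of interest. -/

section Pairing

variable {d : ℕ} {Ω : Opens (Space d)}

lemma pairing_eq_inner (v : H10 Ω) (μ : L2 Ω) : pairing v μ = inner ℝ μ (val v) := by
  rw [L2.inner_def]
  rfl

/-- The pairing `b(·, μ)` as a continuous linear functional, depending linearly on `μ`. -/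
noncomputable def pairingL : L2 Ω →ₗ[ℝ] H10 Ω →L[ℝ] ℝ where
  toFun μ := (innerSL ℝ μ) ∘L (WithLp.fstL 2 ℝ (L2 Ω) (L2Vec Ω)) ∘L (H10 Ω).subtypeL
  map_add' μ ν := by ext; simp
  map_smul' c μ := by ext; simp

lemma pairingL_apply (v : H10 Ω) (μ : L2 Ω) : pairingL μ v = pairing v μ := by
  rw [pairing_eq_inner]
  rfl

lemma exists_val_eq_testFunction (φ : 𝓓(Ω, ℝ)) : ∃ v : H10 Ω,
    val v =ᵐ[(volume : Measure (Space d)).restrict (Ω : Set (Space d))] φ := by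
  have hg : MemLp (gradient φ) 2 ((volume : Measure (Space d)).restrict (Ω : Set (Space d))) := by
    have hc : Continuous (gradient φ) :=
      (InnerProductSpace.toDual ℝ (Space d)).symm.continuous.comp
        (φ.contDiff.continuous_fderiv (by simp))
    refine (hc.memLp_of_hasCompactSupport ?_).restrict _
    exact (φ.hasCompactSupport.fderiv ℝ).comp_left (map_zero _)
  refine ⟨⟨WithLp.toLp 2 ((memLp_testFunction φ).toLp, hg.toLp),
    Submodule.le_topologicalClosure _ (Submodule.subset_span
      ⟨φ, (memLp_testFunction φ).coeFn_toLp, hg.coeFn_toLp⟩)⟩, (memLp_testFunction φ).coeFn_toLp⟩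

/-- `H¹₀(Ω)` is dense in `L²(Ω)`: only `0` is orthogonal to it. -/
lemma pairingL_injective : Function.Injective (pairingL : L2 Ω →ₗ[ℝ] H10 Ω →L[ℝ] ℝ) := by
  rw [injective_iff_map_eq_zero]
  intro μ hμ
  have hloc : LocallyIntegrableOn μ (Ω : Set (Space d)) volume := by
    refine (locallyIntegrableOn_iff (μ := volume) Ω.isOpen.isLocallyClosed).2 fun K hK hKc => ?_
    have : IsFiniteMeasure ((volume : Measure (Space d)).restrict K) :=
      ⟨by simpa using hKc.measure_lt_top⟩
    have h : MemLp μ 2 ((volume : Measure (Space d)).restrict K) :=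
      (Lp.memLp μ).mono_measure (Measure.restrict_mono hK le_rfl)
    exact h.integrable (by norm_num)
  -- Fundamental lemma of the calculus of variations: every test function underlies an element of
  -- `H¹₀(Ω)`.
  have h0 := IsOpen.ae_eq_zero_of_integral_contDiff_smul_eq_zero Ω.isOpen hloc ?_
  · refine (Lp.eq_zero_iff_ae_eq_zero).2 ?_
    exact (ae_restrict_iff' Ω.isOpen.measurableSet).2 h0
  intro g hg hgc hgs
  let φ : 𝓓(Ω, ℝ) := ⟨g, hg, hgc, hgs⟩
  obtain ⟨v, hv⟩ := exists_val_eq_testFunction φ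
  have h1 : pairing v μ = 0 := by rw [← pairingL_apply, hμ]; rfl
  rw [← setIntegral_eq_integral_of_forall_compl_eq_zero (s := (Ω : Set (Space d))), ← h1, pairing]
  · refine integral_congr_ae ?_
    filter_upwards [hv] with x hx
    rw [hx]
    rfl
  · intro x hx
    rw [image_eq_zero_of_notMem_tsupport fun h => hx (hgs h), zero_smul]

/-- The complement of the support of a measure is null, so `Λ` vanishes almost everywhere off its
essential support. -/
lemma qoi_eq_pairing (Λ : L2 Ω) (v : H10 Ω) : qoi Λ v = pairing v Λ := by
  set ν := (volume : Measure (Space d)).restrict (Ω : Set (Space d)) with hν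
  have hcl : IsClosed (essSupport Λ) := Measure.isClosed_support
  have h0 : ∀ᵐ x ∂ν, x ∉ essSupport Λ → Λ x = 0 := by
    have h : (ν.withDensity fun x => ‖Λ x‖ₑ) (essSupport Λ)ᶜ = 0 :=
      Measure.measure_compl_support
    rw [withDensity_apply_eq_zero' (Lp.aestronglyMeasurable Λ).enorm] at h
    rw [ae_iff]
    refine measure_mono_null (fun x hx => ?_) h
    simp only [Set.mem_ofPred_eq, Classical.not_imp] at hx
    exact ⟨by simpa using hx.2, hx.1⟩
  rw [qoi, pairing, Set.inter_comm, ← Measure.restrict_restrict hcl.measurableSet]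
  refine setIntegral_eq_integral_of_ae_compl_eq_zero ?_
  filter_upwards [h0] with x hx hxs
  rw [hx hxs, mul_zero]

end Pairing

end LOD

namespace LOD

/-! ### The moment isomorphism, the saddle point problems and the projection. -/

section PrototypicalBasis

variable {d : ℕ} {Ω : Opens (Space d)} {α β : ℝ}

lemma Mesh.isBounded (𝒯 : Mesh Ω) : Bornology.IsBounded (Ω : Set (Space d)) := by
  refine Bornology.IsBounded.subset ?_ subset_closure
  rw [← 𝒯.space_eq, Geometry.SimplicialComplex.space]
  refine (Bornology.isBounded_biUnion 𝒯.finite_faces).2 fun s _ => ?_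
  exact isBounded_convexHull.2 s.finite_toSet.isBounded

variable {M : Submodule ℝ (L2 Ω)} {J : ℕ}

lemma pairing_eq_sum_repr (Λ : Module.Basis (Fin J) ℝ M) (v : H10 Ω) (μ : M) :
    pairing v (μ : L2 Ω) = ∑ i, Λ.repr μ i * pairing v (Λ i : L2 Ω) := by
  have h : (μ : L2 Ω) = ∑ i, Λ.repr μ i • (Λ i : L2 Ω) := by
    refine (congrArg M.subtype (Λ.sum_repr μ)).symm.trans ?_
    simp only [map_sum, map_smul, Submodule.subtype_apply]
  conv_lhs => rw [h]
  rw [← pairingL_apply, map_sum, _root_.sum_apply]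
  simp [pairingL_apply]

lemma mem_fineScale_iff (Λ : Module.Basis (Fin J) ℝ M) (v : H10 Ω) :
    v ∈ fineScale M ↔ ∀ i, pairing v (Λ i : L2 Ω) = 0 := by
  refine ⟨fun h i => h _ (Λ i).2, fun h μ hμ => ?_⟩
  rw [pairing_eq_sum_repr Λ v ⟨μ, hμ⟩]
  simp [h]

/-- The elements of the multiscale space represent functionals `b(·, μ)` with `μ ∈ M`. -/
lemma exists_of_mem_multiscale (A : Coefficient Ω α β) (Λ : Module.Basis (Fin J) ℝ M)
    {u : H10 Ω} (hu : u ∈ multiscale A M) :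
    ∃ μ : M, ∀ v, energy A u v + pairing v (μ : L2 Ω) = 0 := by
  have h : energy A u ∈ Submodule.span ℝ
      (Set.range fun i => (pairingL (Λ i : L2 Ω) : H10 Ω →ₗ[ℝ] ℝ)) := by
    -- A functional vanishing on the common kernel of finitely many functionals is a linear
    -- combination of them.
    refine mem_span_of_iInf_ker_le_ker fun v hv => hu v ((mem_fineScale_iff Λ v).2 fun i => ?_)
    rw [← pairingL_apply]
    exact (Submodule.mem_iInf _).1 hv i
  obtain ⟨c, hc⟩ := (Submodule.mem_span_range_iff_exists_fun ℝ).1 h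
  refine ⟨-∑ i, c i • Λ i, fun v => ?_⟩
  have h1 := LinearMap.congr_fun hc v
  rw [LinearMap.sum_apply] at h1
  rw [← h1, ← pairingL_apply]
  simp

lemma IsSaddlePoint.mem_multiscale {A : Coefficient Ω α β} {Λ : Module.Basis (Fin J) ℝ M}
    {j : Fin J} {φ : H10 Ω} {μ : M} (h : IsSaddlePoint A Λ j φ μ) : φ ∈ multiscale A M := by
  intro w hw
  have := h.1 w
  rwa [hw _ μ.2, add_zero] at this

lemma IsSaddlePoint.pairing_eq {A : Coefficient Ω α β} {Λ : Module.Basis (Fin J) ℝ M}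
    {j : Fin J} {φ : H10 Ω} {μ : M} (h : IsSaddlePoint A Λ j φ μ) (i : Fin J) :
    pairing φ (Λ i : L2 Ω) = (Pi.single j 1 : Fin J → ℝ) i := by
  rw [h.2 (Λ i), Module.Basis.repr_self, Finsupp.single_apply, Pi.single_apply]

/-- The values `b(v, Λ_i)` of an element of the multiscale space. -/
noncomputable def moments (A : Coefficient Ω α β) (Λ : Module.Basis (Fin J) ℝ M) :
    multiscale A M →ₗ[ℝ] Fin J → ℝ :=
  LinearMap.pi fun i => (pairingL (Λ i : L2 Ω) : H10 Ω →ₗ[ℝ] ℝ) ∘ₗ (multiscale A M).subtype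

lemma moments_apply (A : Coefficient Ω α β) (Λ : Module.Basis (Fin J) ℝ M)
    (v : multiscale A M) (i : Fin J) :
    moments A Λ v i = pairing (v : H10 Ω) (Λ i : L2 Ω) :=
  pairingL_apply _ _

lemma moments_injective (A : Coefficient Ω α β) (hα : 0 < α)
    (hΩ : Bornology.IsBounded (Ω : Set (Space d))) (k : Fin d)
    (Λ : Module.Basis (Fin J) ℝ M) : Function.Injective (moments A Λ) := by
  rw [injective_iff_map_eq_zero]
  intro v hv
  have hw : (v : H10 Ω) ∈ fineScale M := (mem_fineScale_iff Λ _).2 fun i => by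
    rw [← moments_apply A, hv, Pi.zero_apply]
  exact Subtype.ext (eq_zero_of_energy_self A hα hΩ k (v.2 _ hw))

lemma moments_bijective (A : Coefficient Ω α β) (hα : 0 < α) (hαβ : α ≤ β)
    (hΩ : Bornology.IsBounded (Ω : Set (Space d))) (k : Fin d)
    (Λ : Module.Basis (Fin J) ℝ M) : Function.Bijective (moments A Λ) := by
  have hinj := moments_injective A hα hΩ k Λ
  refine ⟨hinj, ?_⟩
  choose ψ hψ using fun i => exists_energy_eq A hα hαβ hΩ k (pairingL (Λ i : L2 Ω))
  have hmem : ∀ i, ψ i ∈ multiscale A M := fun i w hw => by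
    rw [hψ, pairingL_apply]
    exact hw _ (Λ i).2
  -- A relation among the `ψ i` makes the same combination of the `Λ i` orthogonal to `H¹₀(Ω)`,
  -- hence zero by density.
  have hind : LinearIndependent ℝ fun i => (⟨ψ i, hmem i⟩ : multiscale A M) := by
    rw [Fintype.linearIndependent_iff]
    intro c hc
    have h0 : ∑ i, c i • ψ i = 0 := by simpa using congrArg Subtype.val hc
    have h1 : pairingL (∑ i, c i • (Λ i : L2 Ω)) = 0 := by
      ext v
      have h2 : energy A (∑ i, c i • ψ i) v = 0 := by rw [h0]; simp
      rw [map_sum, LinearMap.sum_apply] at h2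
      rw [map_sum, _root_.sum_apply]
      simpa [hψ] using h2
    have h3 : ∑ i, c i • Λ i = 0 := Subtype.ext (by
      simpa using pairingL_injective (h1.trans (map_zero _).symm))
    exact Fintype.linearIndependent_iff.1 Λ.linearIndependent c h3
  have hfin : FiniteDimensional ℝ (multiscale A M) := FiniteDimensional.of_injective _ hinj
  have hle := hind.fintype_card_le_finrank
  have hge := LinearMap.finrank_le_finrank_of_injective hinj
  refine (LinearMap.injective_iff_surjective_of_finrank_eq_finrank (le_antisymm hge ?_)).1 hinj
  simpa using hle

lemma existsUnique_isSaddlePoint (A : Coefficient Ω α β) (hα : 0 < α) (hαβ : α ≤ β)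
    (hΩ : Bornology.IsBounded (Ω : Set (Space d))) (k : Fin d)
    (Λ : Module.Basis (Fin J) ℝ M) (j : Fin J) :
    ∃! s : H10 Ω × M, IsSaddlePoint A Λ j s.1 s.2 := by
  have hbij := moments_bijective A hα hαβ hΩ k Λ
  obtain ⟨u, hu⟩ := hbij.2 (Pi.single j 1)
  obtain ⟨μ, hμ⟩ := exists_of_mem_multiscale A Λ u.2
  have hs : IsSaddlePoint A Λ j u μ := by
    refine ⟨hμ, fun ν => ?_⟩
    rw [pairing_eq_sum_repr Λ]
    simp_rw [← moments_apply A, hu]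
    simp [Pi.single_apply]
  refine ⟨(u, μ), hs, ?_⟩
  rintro ⟨φ, ν⟩ h
  dsimp only at h
  have h1 : (⟨φ, h.mem_multiscale⟩ : multiscale A M) = u := hbij.1 <| by
    ext i
    rw [hu, moments_apply, h.pairing_eq]
  have h2 : φ = u := congrArg Subtype.val h1
  subst h2
  refine Prod.ext rfl (Subtype.ext (pairingL_injective ?_))
  ext v
  rw [pairingL_apply, pairingL_apply]
  linarith [h.1 v, hμ v]

lemma exists_basis_of_isSaddlePoint (A : Coefficient Ω α β) (hα : 0 < α) (hαβ : α ≤ β)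
    (hΩ : Bornology.IsBounded (Ω : Set (Space d))) (k : Fin d)
    (Λ : Module.Basis (Fin J) ℝ M) {φ : Fin J → H10 Ω} {μ : Fin J → M}
    (h : ∀ j, IsSaddlePoint A Λ j (φ j) (μ j)) :
    ∃ B : Module.Basis (Fin J) ℝ (multiscale A M), ∀ j, (B j : H10 Ω) = φ j := by
  have hbij := moments_bijective A hα hαβ hΩ k Λ
  refine ⟨Module.Basis.ofEquivFun (LinearEquiv.ofBijective (moments A Λ) hbij), fun j => ?_⟩
  refine congrArg Subtype.val (a₂ := (⟨φ j, (h j).mem_multiscale⟩ : multiscale A M)) (hbij.1 ?_)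
  ext i
  rw [moments_apply _ _ ⟨φ j, _⟩, (h j).pairing_eq, Module.Basis.coe_ofEquivFun]
  exact congrFun (LinearEquiv.apply_symm_apply
    (LinearEquiv.ofBijective (moments A Λ) hbij) (Pi.single j 1)) i

/-- The energy projection exists, and it preserves the moments `b(·, Λ_i)`. -/
lemma exists_isEnergyProjection (A : Coefficient Ω α β) (hα : 0 < α) (hαβ : α ≤ β)
    (hΩ : Bornology.IsBounded (Ω : Set (Space d))) (k : Fin d)
    (Λ : Module.Basis (Fin J) ℝ M) :
    ∃ R : H10 Ω →ₗ[ℝ] multiscale A M, IsEnergyProjection A M R ∧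
      ∀ v i, pairing (R v : H10 Ω) (Λ i : L2 Ω) = pairing v (Λ i : L2 Ω) := by
  have hbij := moments_bijective A hα hαβ hΩ k Λ
  let e := LinearEquiv.ofBijective (moments A Λ) hbij
  let R : H10 Ω →ₗ[ℝ] multiscale A M :=
    (e.symm : (Fin J → ℝ) →ₗ[ℝ] multiscale A M) ∘ₗ
      LinearMap.pi fun i => (pairingL (Λ i : L2 Ω) : H10 Ω →ₗ[ℝ] ℝ)
  have hR : ∀ v i, pairing (R v : H10 Ω) (Λ i : L2 Ω) = pairing v (Λ i : L2 Ω) := by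
    intro v i
    rw [← moments_apply, ← pairingL_apply v]
    exact congrFun (e.apply_symm_apply _) i
  refine ⟨R, fun v w hw => ?_, hR⟩
  -- `v - R v` has zero moments, so it lies in `W`, to which every `w ∈ Ṽ` is `a`-orthogonal.
  rw [energy_comm]
  refine hw _ ((mem_fineScale_iff Λ _).2 fun i => ?_)
  rw [← pairingL_apply, map_sub, pairingL_apply, pairingL_apply, hR, sub_self]

lemma IsEnergyProjection.unique {A : Coefficient Ω α β} (hα : 0 < α)
    (hΩ : Bornology.IsBounded (Ω : Set (Space d))) (k : Fin d)
    {R S : H10 Ω →ₗ[ℝ] multiscale A M} (hR : IsEnergyProjection A M R)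
    (hS : IsEnergyProjection A M S) : R = S := by
  ext1 v
  rw [← sub_eq_zero]
  refine Subtype.ext (eq_zero_of_energy_self A hα hΩ k ?_)
  have h1 := hR v _ (R v - S v).2
  have h2 := hS v _ (R v - S v).2
  rw [map_sub, LinearMap.sub_apply] at h1 h2
  have h3 : energy A ((R v : H10 Ω) - S v) (R v - S v : multiscale A M) = 0 := by
    rw [map_sub, LinearMap.sub_apply]
    linarith
  exact h3

end PrototypicalBasis

end LOD

theorem mainTheorem7 {d : ℕ} (hd : d = 2 ∨ d = 3)
    (Ω : TopologicalSpace.Opens (LOD.Space d))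
    {α β : ℝ} (hα : 0 < α) (hαβ : α ≤ β) (A : LOD.Coefficient Ω α β)
    (𝒯 : LOD.Mesh Ω) (p : ℕ) (κ : LOD.Variant)
    {J : ℕ} (Λ : Module.Basis (Fin J) ℝ (LOD.femSpace κ 𝒯 p)) :
    (∀ j : Fin J, ∃! s : LOD.H10 Ω × LOD.femSpace κ 𝒯 p, LOD.IsSaddlePoint A Λ j s.1 s.2) ∧
    (∃! R : LOD.H10 Ω →ₗ[ℝ] LOD.multiscale A (LOD.femSpace κ 𝒯 p),
      LOD.IsEnergyProjection A (LOD.femSpace κ 𝒯 p) R) ∧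
    ∀ (φ : Fin J → LOD.H10 Ω) (lam : Fin J → LOD.femSpace κ 𝒯 p),
      (∀ j, LOD.IsSaddlePoint A Λ j (φ j) (lam j)) →
        (∃ B : Module.Basis (Fin J) ℝ (LOD.multiscale A (LOD.femSpace κ 𝒯 p)),
          ∀ j, (B j : LOD.H10 Ω) = φ j) ∧
        ∀ R : LOD.H10 Ω →ₗ[ℝ] LOD.multiscale A (LOD.femSpace κ 𝒯 p),
          LOD.IsEnergyProjection A (LOD.femSpace κ 𝒯 p) R →
            ∀ v : LOD.H10 Ω,
              (R v : LOD.H10 Ω) = ∑ j : Fin J, LOD.qoi (Λ j : LOD.L2 Ω) v • φ j := by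
  -- A coordinate direction for Poincaré's inequality.
  have k : Fin d := ⟨0, by omega⟩
  have hΩ := 𝒯.isBounded
  obtain ⟨S, hS, hSp⟩ := LOD.exists_isEnergyProjection A hα hαβ hΩ k Λ
  refine ⟨LOD.existsUnique_isSaddlePoint A hα hαβ hΩ k Λ,
    ⟨S, hS, fun R hR => LOD.IsEnergyProjection.unique hα hΩ k hR hS⟩, fun φ lam h =>
    ⟨LOD.exists_basis_of_isSaddlePoint A hα hαβ hΩ k Λ h, fun R hR v => ?_⟩⟩
  obtain rfl := LOD.IsEnergyProjection.unique hα hΩ k hR hS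
  have hmem : ∑ j : Fin J, LOD.qoi (Λ j : LOD.L2 Ω) v • φ j ∈
      LOD.multiscale A (LOD.femSpace κ 𝒯 p) :=
    Submodule.sum_mem _ fun j _ => Submodule.smul_mem _ _ (h j).mem_multiscale
  -- Both sides lie in `Ṽ`, so comparing moments suffices; the `i`-th moment of each is `b(v, Λ_i)`.
  refine congrArg Subtype.val (a₂ := ⟨_, hmem⟩) (LOD.moments_injective A hα hΩ k Λ ?_)
  ext i
  rw [LOD.moments_apply, hSp, LOD.moments_apply, ← LOD.pairingL_apply (∑ j, _), map_sum]
  simp [LOD.pairingL_apply, LOD.qoi_eq_pairing, (h _).pairing_eq, Pi.single_apply]
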